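/- All vector spaces, algebras and tensor products are over $\mathbb{C}$. Let $H$ be a finite-dimensional Hopf algebra with comultiplication $\Delta(h)=\sum h_1\otimes h_2$ and counit $\epsilon$. Let $V$ be a vertex algebra with vacuum $\mathbf 1$ and state-field map $Y$ (satisfying truncation, the vacuum and creation axioms, and the Jacobi identity), such that the linear map $$\pi_2\colon V\otimes V\to V((z)),\qquad u\otimes v\mapsto Y(u,z)v,$$ is injective. Suppose that $V$ is an $H$-module vertex algebra, i.e. $V$ is an $H$-module such that $$h\mathbf 1=\epsilon(h)\mathbf 1,\qquad h\,(Y(u,z)v)=\sum Y(h_1u,z)\,h_2v\qquad\text{for all } h\in H,\ u,v\in V,$$ where $h$ acts on $V((z))$ coefficientwise, and that the action is inner faithful, i.e. $IV\neq 0$ for every nonzero Hopf ideal $I$ of $H$ (a two-sided ideal $I$ with $\Delta(I)\subseteq H\otimes I+I\otimes H$, $\epsilon(I)=0$ and $S(I)\subseteq I$, where $S$ is the antipode). Then $H$ is cocommutative, i.e. $\sum h_1\otimes h_2=\sum h_2\otimes h_1$ for all $h\in H$, and $H$ is a group algebra, i.e. $H\cong\mathbb{C}[G]$ as Hopf algebras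 for some group $G$. -/

import Mathlib

universe u v

noncomputable section

open scoped TensorProduct

/-- A vertex algebra structure on a complex vector space `V`.

The state-field map is `Y : V → (V → V((z)))`: a `VertexOperator ℂ V` is a linear map from `V` to
the Laurent series `V((z))`, so the truncation condition (`u_n v = 0` for `n` sufficiently large)
is part of the type of `Y`. The mode `u_n`, i.e. the coefficient of `z ^ (-n - 1)` in `Y(u, z)`, is
`VertexOperator.ncoeff (Y u) n`. -/
class VertexAlgebra (V : Type v) [AddCommGroup V] [Module ℂ V] where
  /-- the vacuum vector -/
  vac : V
  /-- the state-field map `u ↦ Y(u, z)` -/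
  Y : V →ₗ[ℂ] VertexOperator ℂ V
  /-- `Y(vac, z) v = v`, the constant series -/
  Y_vac : ∀ v : V, Y vac v = HahnModule.of ℂ (HahnSeries.single (0 : ℤ) v)
  /-- `Y(u, z) vac` has no negative powers of `z` ... -/
  ncoeff_vac_of_nonneg : ∀ (u : V) (n : ℤ), 0 ≤ n → VertexOperator.ncoeff (Y u) n vac = 0
  /-- ... and constant term `u` -/
  ncoeff_neg_one_vac : ∀ u : V, VertexOperator.ncoeff (Y u) (-1) vac = u
  /-- The Jacobi identity, applied to a vector `w`: this is the equality of the coefficients of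
  `z₀ ^ (-r - 1) z₁ ^ (-p - 1) z₂ ^ (-q - 1)` on both sides, for all integers `p`, `q`, `r`, the
  binomials being expanded in nonnegative powers of the second variable:
  `z₀⁻¹ δ((z₁ - z₂) / z₀) = ∑ₙ ∑ᵢ (-1) ^ i (n choose i) z₀ ^ (-n - 1) z₁ ^ (n - i) z₂ ^ i`,
  `z₀⁻¹ δ((z₂ - z₁) / -z₀) = ∑ₙ ∑ᵢ (-1) ^ (n + i) (n choose i) z₀ ^ (-n - 1) z₂ ^ (n - i) z₁ ^ i`,
  `z₂⁻¹ δ((z₁ - z₀) / z₂) = ∑ₙ ∑ᵢ (-1) ^ i (n choose i) z₂ ^ (-n - 1) z₁ ^ (n - i) z₀ ^ i`;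
  in the last one `n = i - p - 1`.
  All three sums over `i` have only finitely many nonzero terms, by truncation. -/
  jacobi : ∀ (u v w : V) (p q r : ℤ),
    (∑ᶠ i : ℕ, ((-1 : ℤ) ^ i * Ring.choose r i) •
        VertexOperator.ncoeff (Y u) (p + r - i) (VertexOperator.ncoeff (Y v) (q + i) w)) -
      (∑ᶠ i : ℕ, ((Int.negOnePow r : ℤ) * (-1 : ℤ) ^ i * Ring.choose r i) •
        VertexOperator.ncoeff (Y v) (q + r - i) (VertexOperator.ncoeff (Y u) (p + i) w)) =
    ∑ᶠ i : ℕ, ((-1 : ℤ) ^ i * Ring.choose ((i : ℤ) - p - 1) i) •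
        VertexOperator.ncoeff (Y (VertexOperator.ncoeff (Y u) (r + i) v)) (p + q - i) w

namespace VertexAlgebra

/-- The linear map `π₂ : V ⊗ V → V((z))`, `u ⊗ v ↦ Y(u, z) v`. -/
def piTwo (V : Type v) [AddCommGroup V] [Module ℂ V] [VertexAlgebra V] :
    V ⊗[ℂ] V →ₗ[ℂ] HahnModule ℤ ℂ V :=
  TensorProduct.lift (Y : V →ₗ[ℂ] V →ₗ[ℂ] HahnModule ℤ ℂ V)

/-- `V` is `π₂`-injective if the map `π₂` is injective. -/
def IsPiTwoInjective (V : Type v) [AddCommGroup V] [Module ℂ V] [VertexAlgebra V] : Prop :=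
  Function.Injective (piTwo V)

end VertexAlgebra

open Coalgebra in
/-- An `H`-module `V` is an `H`-module vertex algebra if `h 1 = ε(h) 1` and
`h (Y(u, z) v) = ∑ Y(h₁ u, z) (h₂ v)` where `Δ(h) = ∑ h₁ ⊗ h₂`; the second condition is
stated for each coefficient of the series, on which `h` acts. Here `ℛ ℂ h` is a chosen way to
write `Δ(h)` as a finite sum of pure tensors; the sum does not depend on the choice. -/
structure IsHopfModuleVertexAlgebra (H : Type u) [Ring H] [HopfAlgebra ℂ H]
    (V : Type v) [AddCommGroup V] [Module ℂ V] [Module H V] [IsScalarTower ℂ H V]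
    [VertexAlgebra V] : Prop where
  smul_vac : ∀ h : H,
    h • (VertexAlgebra.vac : V) = (counit (R := ℂ) h) • (VertexAlgebra.vac : V)
  smul_ncoeff : ∀ (h : H) (u v : V) (n : ℤ),
    h • VertexOperator.ncoeff (VertexAlgebra.Y u) n v =
      ∑ i ∈ (ℛ ℂ h).index,
        VertexOperator.ncoeff (VertexAlgebra.Y ((ℛ ℂ h).left i • u)) n ((ℛ ℂ h).right i • v)

/-- An `H`-module `M` is inner faithful if `I M ≠ 0` for every nonzero Hopf ideal `I` of `H`. -/
def IsInnerFaithful (H : Type u) [Ring H] [HopfAlgebra ℂ H]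
    (M : Type v) [AddCommGroup M] [Module H M] : Prop :=
  ∀ I : Ideal H, I.IsTwoSided → I.IsHopfIdeal ℂ → I ≠ ⊥ → ∃ a ∈ I, ∃ m : M, a • m ≠ 0

/-- A Hopf algebra over `ℂ` is a group algebra if it is isomorphic, as a Hopf algebra, to `ℂ[G]`
with its usual Hopf algebra structure, for some group `G`. (Bialgebra isomorphisms between Hopf
algebras automatically commute with the antipodes.) -/
def IsGroupAlgebra (H : Type u) [Ring H] [HopfAlgebra ℂ H] : Prop :=
  ∃ (G : Type u) (_ : Group G), Nonempty (H ≃ₐc[ℂ] MonoidAlgebra ℂ G)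

end

/-! Skew-symmetry expresses `v_r u` through the vectors `(u_{r+i} v)_{-1-i} 1`, and `H` acts on the
vacuum by the counit. Expanding `h (v_r u)` directly and via skew-symmetry therefore gives the same
value for `Δ(h)` and its flip (`lift_nthProduct_map_comm`); as `π₂` is injective, their difference
kills `V ⊗ V`. Injectivity also makes the annihilator of `V` a coideal when `V ≠ 0`, hence a Hopf
ideal by finite dimension, so it is zero by inner faithfulness. Thus `H` is cocommutative. The dual
algebra `H*` is then commutative, with maximal ideals the kernels of evaluation at group-likes. A
non-idempotent one would carry a nonzero point derivation; translated to the identity, this is a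
primitive element of `H`, which induces a derivation of `H*` that moves the ideal, impossible in
characteristic zero. So group-likes separate `H*`, they span `H`, and `H = ℂ[G]`. -/

open scoped TensorProduct
open Coalgebra WithConv

/-! ### Derivations and idempotent maximal ideals -/

section Derivations

variable {k A : Type*} [Field k] [CommRing A] [Algebra k A]

/-- A derivation maps `I ^ (n + 1)` into `I ^ n`. -/
theorem Derivation.apply_mem_pow_of_mem_pow_succ (D : Derivation k A A) (I : Ideal A) (n : ℕ)
    {x : A} (hx : x ∈ I ^ (n + 1)) : D x ∈ I ^ n := by
  induction n generalizing x with
  | zero => simp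
  | succ n ih =>
    rw [pow_succ] at hx
    induction hx using Submodule.mul_induction_on' with
    | mem_mul_mem a ha b hb =>
      rw [D.leibniz, smul_eq_mul, smul_eq_mul]
      refine add_mem (Ideal.mul_mem_right _ _ ha) ?_
      rw [pow_succ, mul_comm b]
      exact Ideal.mul_mem_mul (ih ha) hb
    | add a _ b _ ha hb => rw [map_add]; exact add_mem ha hb

/-- In characteristic zero, derivations of an Artinian algebra preserve its maximal ideals. -/
theorem Derivation.apply_mem_of_isMaximal [CharZero k] [IsArtinianRing A]
    (D : Derivation k A A) (M : Ideal A) [hM : M.IsMaximal] {x : A} (hx : x ∈ M) : D x ∈ M := by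
  by_contra hDx
  obtain ⟨K, hK⟩ := IsArtinian.monotone_stabilizes
    (⟨fun n => OrderDual.toDual (M ^ n), fun _ _ h => Ideal.pow_le_pow_right h⟩ :
      ℕ →o (Submodule A A)ᵒᵈ)
  have hK' : M ^ K = M ^ (K + 1) := hK (K + 1) (Nat.le_succ K)
  -- If `D x ∉ M`, then `D x` is a unit modulo `M ^ K`.
  have hcop : IsCoprime (Ideal.span {D x}) (M ^ K) := by
    refine IsCoprime.pow_right ?_
    rw [Ideal.isCoprime_iff_sup_eq, sup_comm]
    refine hM.1.2 _ (lt_of_le_of_ne le_sup_left fun h => hDx ?_)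
    rw [h]
    exact Ideal.mem_sup_right (Ideal.mem_span_singleton_self _)
  obtain ⟨a, ha, b, hb, hab⟩ := Ideal.isCoprime_iff_exists.1 hcop
  obtain ⟨c, rfl⟩ := Ideal.mem_span_singleton'.1 ha
  -- Apply `D` and cancel the units `n + 1` and `D x`; no power is lost because `M ^ K = M ^ (K +
  -- 1)`.
  have step (n : ℕ) (h : x ^ (n + 1) ∈ M ^ K) : x ^ n ∈ M ^ K := by
    have h1 : D (x ^ (n + 1)) ∈ M ^ K := D.apply_mem_pow_of_mem_pow_succ M K (hK' ▸ h)
    rw [D.leibniz_pow, Nat.add_sub_cancel, ← Nat.cast_smul_eq_nsmul k, smul_eq_mul] at h1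
    have h2 := Submodule.smul_of_tower_mem (M ^ K) (((n + 1 : ℕ) : k)⁻¹) h1
    rw [smul_smul, inv_mul_cancel₀ (Nat.cast_ne_zero.2 n.succ_ne_zero), one_smul] at h2
    rw [← mul_one (x ^ n), ← hab, mul_add, mul_left_comm]
    exact add_mem (Ideal.mul_mem_left _ _ h2) (Ideal.mul_mem_left _ _ hb)
  have all (n : ℕ) : x ^ n ∈ M ^ K → (1 : A) ∈ M ^ K := by
    induction n with
    | zero => simp
    | succ n ih => exact fun h => ih (step n h)
  have h1 : (1 : A) ∈ M ^ (K + 1) := hK' ▸ all K (Ideal.pow_mem_pow hx K)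
  exact hM.ne_top ((Ideal.eq_top_iff_one _).2 (Ideal.pow_le_self K.succ_ne_zero h1))

/-- If all maximal ideals of a Noetherian ring are idempotent, then their intersection is zero. -/
theorem eq_zero_of_forall_mem_of_isIdempotentElem {A : Type*} [CommRing A] [IsNoetherianRing A]
    (h : ∀ M : Ideal A, M.IsMaximal → IsIdempotentElem M) {x : A}
    (hx : ∀ M : Ideal A, M.IsMaximal → x ∈ M) : x = 0 := by
  by_contra hx0
  have hne : Ideal.span {x} ≠ ⊥ := by simpa using hx0
  have hann : (Submodule.annihilator (Ideal.span {x})) ≠ ⊤ := by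
    rwa [Ne, Submodule.annihilator_eq_top_iff]
  obtain ⟨M, hM, hle⟩ := Ideal.exists_le_maximal _ hann
  obtain ⟨e, he, rfl⟩ := (Ideal.isIdempotentElem_iff_of_fg M
    (IsNoetherian.noetherian M)).1 (h M hM)
  obtain ⟨c, hc⟩ := Ideal.mem_span_singleton'.1 (hx _ hM)
  -- Since `x = c * e`, the element `1 - e` kills `x` and so lies in `M`, together with `e`.
  have h1 : (1 - e) ∈ Submodule.annihilator (Ideal.span {x}) := by
    rw [Ideal.span, Submodule.mem_annihilator_span_singleton, smul_eq_mul, ← hc]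
    linear_combination (-c) * he.eq
  have h2 := add_mem (hle h1) (Ideal.mem_span_singleton_self e)
  rw [sub_add_cancel] at h2
  exact hM.ne_top ((Ideal.eq_top_iff_one _).2 h2)

end Derivations

/-! ### Separation by functionals -/

section Separation

variable {k V W : Type*} [Field k] [AddCommGroup V] [Module k V] [AddCommGroup W] [Module k W]
  [FiniteDimensional k V] [FiniteDimensional k W]

/-- A tensor is zero if it is killed by all pure tensors of functionals. -/
theorem TensorProduct.eq_zero_of_forall_dualDistrib {t : V ⊗[k] W}
    (h : ∀ (φ : Module.Dual k V) (ψ : Module.Dual k W), dualDistrib k V W (φ ⊗ₜ ψ) t = 0) :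
    t = 0 := by
  rw [← Module.forall_dual_apply_eq_zero_iff k]
  intro χ
  obtain ⟨s, rfl⟩ := (dualDistribEquiv k V W).surjective χ
  change dualDistrib k V W s t = 0
  induction s using TensorProduct.induction_on with
  | zero => simp
  | tmul φ ψ => exact h φ ψ
  | add a b ha hb => simp [ha, hb]

/-- A functional on `V` vanishing on the common zeros of a family of functionals is in its span. -/
theorem Module.Dual.mem_span_of_forall {S : Set (Module.Dual k V)} {φ : Module.Dual k V}
    (h : ∀ x, (∀ f ∈ S, f x = 0) → φ x = 0) : φ ∈ Submodule.span k S := by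
  rw [← Subspace.dualCoannihilator_dualAnnihilator_eq (W := Submodule.span k S),
    Submodule.mem_dualAnnihilator]
  intro x hx
  exact h x fun f hf => (Submodule.mem_dualCoannihilator _).1 hx f (Submodule.subset_span hf)

end Separation

/-! ### Cocommutative Hopf algebras and their group-likes -/

section GroupLike

variable {k H : Type*} [Field k] [Ring H] [HopfAlgebra k H]

instance WithConv.finite_linearMap {C B : Type*} [AddCommGroup C] [Module k C]
    [AddCommGroup B] [Module k B] [FiniteDimensional k C] [FiniteDimensional k B] :
    Module.Finite k (WithConv (C →ₗ[k] B)) :=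
  Module.Finite.equiv (WithConv.linearEquiv k (C →ₗ[k] B)).symm

/-- Every functional on the dual of a finite-dimensional space is the evaluation at a vector. -/
theorem WithConv.exists_forall_apply_eq {C : Type*} [AddCommGroup C] [Module k C]
    [FiniteDimensional k C] (χ : WithConv (C →ₗ[k] k) →ₗ[k] k) :
    ∃ g : C, ∀ f : WithConv (C →ₗ[k] k), χ f = f g := by
  obtain ⟨g, hg⟩ := (Module.evalEquiv k C).surjective
    (χ ∘ₗ (WithConv.linearEquiv k (C →ₗ[k] k)).symm.toLinearMap)
  exact ⟨g, fun f => (LinearMap.congr_fun hg f.ofConv).symm⟩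

theorem LinearMap.convMul_apply_eq_dualDistrib {C : Type*} [AddCommGroup C] [Module k C]
    [Coalgebra k C] (φ ψ : WithConv (C →ₗ[k] k)) (x : C) :
    (φ * ψ) x = TensorProduct.dualDistrib k C C (φ.ofConv ⊗ₜ ψ.ofConv) (comul x) := by
  rw [(ℛ k x).convMul_apply]
  conv_rhs => rw [← (ℛ k x).eq]
  simp

/-- A vector whose evaluation is multiplicative for the convolution product is group-like. -/
theorem isGroupLikeElem_of_forall_convMul {C : Type*} [AddCommGroup C] [Module k C]
    [Coalgebra k C] [FiniteDimensional k C] {g : C} (h1 : counit (R := k) g = 1)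
    (h : ∀ φ ψ : WithConv (C →ₗ[k] k), (φ * ψ) g = φ g * ψ g) : IsGroupLikeElem k g where
  counit_eq_one := h1
  comul_eq_tmul_self := by
    rw [← sub_eq_zero]
    refine TensorProduct.eq_zero_of_forall_dualDistrib fun φ ψ => ?_
    have := h (toConv φ) (toConv ψ)
    rw [LinearMap.convMul_apply_eq_dualDistrib] at this
    rw [map_sub, this]
    simp

variable [IsCocomm k H]

/-- The derivation of the dual algebra of `H` given by translation by a primitive element. -/
noncomputable def primitiveDerivation (q : H) (hq : comul q = q ⊗ₜ[k] 1 + 1 ⊗ₜ[k] q) :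
    Derivation k (WithConv (H →ₗ[k] k)) (WithConv (H →ₗ[k] k)) :=
  Derivation.mk'
    { toFun := fun f => toConv (f.ofConv ∘ₗ LinearMap.mulRight k q)
      map_add' := fun f g => rfl
      map_smul' := fun c f => rfl } <| by
    intro φ ψ
    ext x
    change (φ * ψ) (x * q) = (φ * toConv (ψ.ofConv ∘ₗ LinearMap.mulRight k q)) x +
      (ψ * toConv (φ.ofConv ∘ₗ LinearMap.mulRight k q)) x
    rw [mul_comm ψ, (ℛ k x).convMul_apply, (ℛ k x).convMul_apply, LinearMap.convMul_apply,
      Bialgebra.comul_mul, hq, ← (ℛ k x).eq]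
    simp [Finset.sum_mul, mul_add, add_comm]

@[simp]
theorem primitiveDerivation_apply (q : H) (hq : comul q = q ⊗ₜ[k] 1 + 1 ⊗ₜ[k] q)
    (f : WithConv (H →ₗ[k] k)) (x : H) : primitiveDerivation q hq f x = f (x * q) := rfl

variable [FiniteDimensional k H] [IsAlgClosed k]

/-- The maximal ideals of the dual algebra are the kernels of evaluations at group-likes. -/
theorem exists_isGroupLikeElem_of_isMaximal (M : Ideal (WithConv (H →ₗ[k] k))) [M.IsMaximal] :
    ∃ g : H, IsGroupLikeElem k g ∧ ∀ f, f ∈ M ↔ f g = 0 := by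
  let := Ideal.Quotient.field M
  have : Module.Finite k (WithConv (H →ₗ[k] k) ⧸ M) :=
    Module.Finite.of_surjective (Ideal.Quotient.mkₐ k M).toLinearMap
      (Ideal.Quotient.mkₐ_surjective k M)
  let e : k ≃ₐ[k] (WithConv (H →ₗ[k] k) ⧸ M) := AlgEquiv.ofBijective (Algebra.ofId _ _)
    IsAlgClosed.algebraMap_bijective_of_isIntegral
  let χ : WithConv (H →ₗ[k] k) →ₐ[k] k := e.symm.toAlgHom.comp (Ideal.Quotient.mkₐ k M)
  obtain ⟨g, hg⟩ := WithConv.exists_forall_apply_eq χ.toLinearMap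
  have hg' (f : WithConv (H →ₗ[k] k)) : χ f = f g := hg f
  refine ⟨g, isGroupLikeElem_of_forall_convMul ?_ fun φ ψ => ?_, fun f => ?_⟩
  · have := hg' 1
    rw [map_one] at this
    simpa using this.symm
  · rw [← hg', ← hg', ← hg', map_mul]
  · rw [← hg']
    change _ ↔ e.symm (Ideal.Quotient.mk M f) = 0
    rw [map_eq_zero_iff _ e.symm.injective, Ideal.Quotient.eq_zero_iff_mem]

/-- In characteristic zero, all maximal ideals of the dual algebra are idempotent. -/
theorem isIdempotentElem_of_isMaximal [CharZero k] (M : Ideal (WithConv (H →ₗ[k] k)))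
    [M.IsMaximal] : IsIdempotentElem M := by
  have : IsArtinianRing (WithConv (H →ₗ[k] k)) := IsArtinianRing.of_finite k _
  obtain ⟨g, hg, hM⟩ := exists_isGroupLikeElem_of_isMaximal M
  refine le_antisymm Ideal.mul_le_left fun f hf => ?_
  by_contra hf2
  -- A functional that kills `M * M` and `1` but not `f` is a point derivation at `g`.
  have hnot : f ∉ (M * M).restrictScalars k ⊔ Submodule.span k {1} := by
    intro h
    obtain ⟨m, hm, c, hc, hmc⟩ := Submodule.mem_sup.1 h
    obtain ⟨c, rfl⟩ := Submodule.mem_span_singleton.1 hc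
    have hm' : m g = 0 := (hM m).1 (Ideal.mul_le_left hm)
    have : f g = 0 := (hM f).1 hf
    rw [← hmc] at this
    have hc0 : c = 0 := by simpa [hm', hg.counit_eq_one] using this
    rw [hc0, zero_smul, add_zero] at hmc
    exact hf2 (hmc ▸ hm)
  obtain ⟨d, hdf, hd⟩ := Submodule.exists_le_ker_of_notMem hnot
  have hd1 : d 1 = 0 := hd (Submodule.mem_sup_right (Submodule.mem_span_singleton_self 1))
  have hd2 (x) (hx : x ∈ M * M) : d x = 0 := hd (Submodule.mem_sup_left hx)
  obtain ⟨p, hp⟩ := WithConv.exists_forall_apply_eq d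
  have hleib (φ ψ : WithConv (H →ₗ[k] k)) : d (φ * ψ) = φ g * d ψ + d φ * ψ g := by
    have hmem (φ : WithConv (H →ₗ[k] k)) : φ - φ g • 1 ∈ M := by
      rw [hM]; simp [hg.counit_eq_one]
    have := hd2 _ (Ideal.mul_mem_mul (hmem φ) (hmem ψ))
    simp only [sub_mul, mul_sub, smul_mul_assoc, mul_smul_comm, mul_one, one_mul, map_sub,
      map_smul, hd1, smul_eq_mul, mul_zero, sub_zero] at this
    linear_combination this
  have hΔ : comul p = p ⊗ₜ[k] g + g ⊗ₜ[k] p := by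
    rw [← sub_eq_zero]
    refine TensorProduct.eq_zero_of_forall_dualDistrib fun φ ψ => ?_
    have := hleib (toConv φ) (toConv ψ)
    rw [hp, LinearMap.convMul_apply_eq_dualDistrib, hp, hp] at this
    rw [map_sub, this]
    simp [add_comm]
  -- Multiplying by `S(g) = g⁻¹` turns the `(g, g)`-primitive `p` into a primitive element.
  have hq : comul (HopfAlgebra.antipode k g * p) =
      (HopfAlgebra.antipode k g * p) ⊗ₜ[k] 1 + 1 ⊗ₜ[k] (HopfAlgebra.antipode k g * p) := by
    rw [Bialgebra.comul_mul, hΔ, hg.antipode.comul_eq_tmul_self]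
    simp [mul_add, hg.antipode_mul_cancel]
  -- The derived functional takes the value `f (g * S(g) * p) = d f` at `g`, yet must vanish there.
  have := (hM _).1 ((primitiveDerivation _ hq).apply_mem_of_isMaximal M hf)
  rw [primitiveDerivation_apply, ← mul_assoc, hg.mul_antipode_cancel, one_mul, ← hp] at this
  exact hdf this

set_option maxHeartbeats 2000000 in
/-- A functional vanishing on all group-like elements is zero. -/
theorem eq_zero_of_forall_isGroupLikeElem [CharZero k] {f : WithConv (H →ₗ[k] k)}
    (hf : ∀ g : H, IsGroupLikeElem k g → f g = 0) : f = 0 := by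
  have : IsNoetherianRing (WithConv (H →ₗ[k] k)) := IsNoetherianRing.of_finite k _
  refine eq_zero_of_forall_mem_of_isIdempotentElem
    (fun M _ => isIdempotentElem_of_isMaximal M) fun M _ => ?_
  obtain ⟨g, hg, hM⟩ := exists_isGroupLikeElem_of_isMaximal M
  exact (hM _).2 (hf g hg)

/-- A finite-dimensional cocommutative Hopf algebra over an algebraically closed field of
characteristic zero is spanned by its group-like elements. -/
theorem span_isGroupLikeElem_eq_top [CharZero k] :
    Submodule.span k {g : H | IsGroupLikeElem k g} = ⊤ := by
  by_contra hne
  obtain ⟨f, hf0, hf⟩ := Submodule.exists_le_ker_of_lt_top _ (lt_top_iff_ne_top.2 hne)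
  exact hf0 (WithConv.toConv_eq_zero.1 (eq_zero_of_forall_isGroupLikeElem
    fun g hg => hf (Submodule.subset_span hg)))

variable (k H) in
theorem MonoidAlgebra.liftGroupLikeBialgHom_bijective [CharZero k] :
    Function.Bijective
      (MonoidAlgebra.liftGroupLikeBialgHom : MonoidAlgebra k (GroupLike k H) →ₐc[k] H) := by
  have hcoe (x : MonoidAlgebra k (GroupLike k H)) :
      MonoidAlgebra.liftGroupLikeBialgHom x =
        Finsupp.linearCombination k (GroupLike.val (R := k) (A := H)) x.coeff := by
    induction x using MonoidAlgebra.induction_linear <;> simp_all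
  constructor
  · intro x y hxy
    rw [hcoe, hcoe] at hxy
    exact MonoidAlgebra.coeff_injective (linearIndep_groupLikeVal hxy)
  · intro y
    have hy : y ∈ Submodule.span k (Set.range (GroupLike.val (R := k) (A := H))) := by
      have : Set.range (GroupLike.val (R := k) (A := H)) = {g : H | IsGroupLikeElem k g} :=
        Set.ext fun g => ⟨fun ⟨a, ha⟩ => ha ▸ a.2, fun h => ⟨⟨g, h⟩, rfl⟩⟩
      rw [this, span_isGroupLikeElem_eq_top]
      trivial
    obtain ⟨c, hc⟩ := (Finsupp.mem_span_range_iff_exists_finsupp).1 hy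
    exact ⟨.ofCoeff c, by rw [hcoe]; exact hc⟩

end GroupLike

theorem isGroupAlgebra_of_isCocomm (H : Type*) [Ring H] [HopfAlgebra ℂ H] [FiniteDimensional ℂ H]
    [IsCocomm ℂ H] : IsGroupAlgebra H :=
  ⟨GroupLike ℂ H, inferInstance,
    ⟨(BialgEquiv.ofBijective _ (MonoidAlgebra.liftGroupLikeBialgHom_bijective ℂ H)).symm⟩⟩

theorem TensorProduct.dualDistrib_map {k M N M' N' : Type*} [CommSemiring k]
    [AddCommMonoid M] [Module k M] [AddCommMonoid N] [Module k N]
    [AddCommMonoid M'] [Module k M'] [AddCommMonoid N'] [Module k N']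
    (f : M →ₗ[k] M') (g : N →ₗ[k] N') (φ : Module.Dual k M') (ψ : Module.Dual k N')
    (s : M ⊗[k] N) : dualDistrib k M' N' (φ ⊗ₜ ψ) (map f g s) =
      dualDistrib k M N ((φ ∘ₗ f) ⊗ₜ (ψ ∘ₗ g)) s := by
  induction s using TensorProduct.induction_on with
  | zero => simp
  | tmul a b => simp
  | add a b ha hb => simp only [map_add, ha, hb]

/-- In a finite-dimensional algebra, a subspace containing `1` and stable under left multiplication
by `a` contains the left inverse of `a`. -/
theorem mem_of_mul_eq_one_of_mul_mem {k A : Type*} [Field k] [Ring A] [Algebra k A]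
    [FiniteDimensional k A] (K : Submodule k A) {a b : A} (hba : b * a = 1) (h1 : 1 ∈ K)
    (ha : ∀ x ∈ K, a * x ∈ K) : b ∈ K := by
  let m : K →ₗ[k] K := (LinearMap.mulLeft k a).restrict ha
  have hinj : Function.Injective m := by
    intro x y hxy
    have h : a * x.1 = a * y.1 := congrArg Subtype.val hxy
    refine Subtype.ext ?_
    rw [← one_mul x.1, ← hba, mul_assoc, h, ← mul_assoc, hba, one_mul]
  obtain ⟨c, hc⟩ := LinearMap.injective_iff_surjective.1 hinj ⟨1, h1⟩
  have hac : a * c.1 = 1 := congrArg Subtype.val hc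
  rw [left_inv_eq_right_inv hba hac]
  exact c.2

/-! ### Coideals and Hopf ideals -/

section HopfIdeals

variable {k H : Type*} [Field k] [Ring H] [HopfAlgebra k H]

/-- In a finite-dimensional Hopf algebra, a two-sided ideal that is a coideal is a Hopf ideal. -/
theorem Ideal.isHopfIdeal_of_isCoideal [FiniteDimensional k H] (I : Ideal H) [I.IsTwoSided]
    (hI : (I.restrictScalars k).IsCoideal) : I.IsHopfIdeal k := by
  refine { hI with antipode_mem := fun x hx => ?_ }
  let π : H →ₗ[k] H ⧸ I := (Ideal.Quotient.mkₐ k I).toLinearMap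
  have hπ (y : H) : π y = 0 ↔ y ∈ I := Ideal.Quotient.eq_zero_iff_mem
  -- `K` consists of the maps vanishing on `I`. It contains the convolution unit and is stable under
  -- `π`, so it contains the convolution inverse `π ∘ S`.
  let K : Submodule k (WithConv (H →ₗ[k] H ⧸ I)) :=
    { carrier := {f | ∀ y ∈ I, f y = 0}
      add_mem' := fun {f g} hf hg y hy => by
        change f y + g y = 0
        rw [hf y hy, hg y hy, add_zero]
      zero_mem' := fun y _ => rfl
      smul_mem' := fun c f hf y hy => by
        change c • f y = 0
        rw [hf y hy, smul_zero] }
  have hmul (f) (hf : f ∈ K) : toConv π * f ∈ K := by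
    intro y hy
    have hle : I.restrictScalars k ≤ LinearMap.ker f.ofConv := hf
    have hf' : f.ofConv = (I.restrictScalars k).liftQ f.ofConv hle ∘ₗ
        (I.restrictScalars k).mkQ := (Submodule.liftQ_mkQ _ _ _).symm
    have hπ' : π = (I.restrictScalars k).liftQ π (fun z hz => (hπ z).2 hz) ∘ₗ
        (I.restrictScalars k).mkQ := (Submodule.liftQ_mkQ _ _ _).symm
    rw [LinearMap.convMul_apply, hf', ofConv_toConv, hπ', TensorProduct.map_comp,
      LinearMap.comp_apply, hI.map_mkQ_comul_eq_zero hy, map_zero, map_zero]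
  have hSπ : toConv (π ∘ₗ HopfAlgebra.antipode k) * toConv π = 1 := by
    have := LinearMap.algHom_comp_convMul_distrib (Ideal.Quotient.mkₐ k I)
      (toConv (HopfAlgebra.antipode k)) (toConv (LinearMap.id (R := k) (M := H)))
    rw [LinearMap.antipode_mul_id] at this
    ext y
    have h2 := LinearMap.congr_fun this y
    refine h2.symm.trans ?_
    simp
  have h1 : (1 : WithConv (H →ₗ[k] H ⧸ I)) ∈ K := by
    intro y hy
    rw [LinearMap.convOne_apply, hI.counit_eq_zero hy, map_zero]
  have := mem_of_mul_eq_one_of_mul_mem K hSπ h1 hmul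
  exact (hπ _).1 (this x hx)

variable (k H) in
/-- The augmentation ideal is a Hopf ideal. -/
theorem HopfAlgebra.isHopfIdeal_ker_counitAlgHom :
    (RingHom.ker (Bialgebra.counitAlgHom k H)).IsHopfIdeal k := by
  set I : Ideal H := RingHom.ker (Bialgebra.counitAlgHom k H)
  have hI (x : H) : x ∈ I ↔ counit (R := k) x = 0 := Iff.rfl
  refine { counit_eq_zero := fun x hx => hx, map_mkQ_comul_eq_zero := fun x hx => ?_,
           antipode_mem := fun x hx => ?_ }
  · have hx' : counit (R := k) x = 0 := hx
    -- Modulo `I`, every `y` equals `ε(y) 1`.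
    have hq : (I.restrictScalars k).mkQ =
        LinearMap.toSpanSingleton k _ ((I.restrictScalars k).mkQ 1) ∘ₗ counit := by
      ext y
      rw [LinearMap.comp_apply, LinearMap.toSpanSingleton_apply, ← map_smul, ← sub_eq_zero,
        ← map_sub, Submodule.mkQ_apply, Submodule.Quotient.mk_eq_zero]
      change counit (R := k) _ = 0
      simp
    have hε : _root_.TensorProduct.map (counit (R := k) (A := H)) (counit (R := k) (A := H)) (comul x)
        = 0 := by
      rw [← LinearMap.lTensor_comp_rTensor, LinearMap.comp_apply, rTensor_counit_comul,
        LinearMap.lTensor_tmul, hx', TensorProduct.tmul_zero]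
    rw [hq, _root_.TensorProduct.map_comp, LinearMap.comp_apply, hε, map_zero]
  · rw [hI, HopfAlgebra.counit_antipode]
    exact hx

/-- If the augmentation ideal of a Hopf algebra is zero, the Hopf algebra is cocommutative. -/
theorem HopfAlgebra.isCocomm_of_ker_counitAlgHom_eq_bot
    (h : RingHom.ker (Bialgebra.counitAlgHom k H) = ⊥) : IsCocomm k H where
  comm_comp_comul := by
    ext x
    have hx : x = counit (R := k) x • 1 := by
      have : x - counit (R := k) x • 1 ∈ RingHom.ker (Bialgebra.counitAlgHom k H) := by
        rw [RingHom.mem_ker, Bialgebra.counitAlgHom_apply]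
        simp
      rw [h, Ideal.mem_bot, sub_eq_zero] at this
      exact this
    rw [hx]
    simp [Algebra.TensorProduct.one_def]

end HopfIdeals

/-! ### Tensors acting by zero -/

section Action

variable (k : Type*) {H V : Type*} [Field k] [Ring H] [Algebra k H] [AddCommGroup V] [Module k V]
  [Module H V] [IsScalarTower k H V]

/-- The orbit map `h ↦ h • v`, linear over the base field. -/
def orbitLinearMap (v : V) : H →ₗ[k] V :=
  (LinearMap.toSpanSingleton H V v).restrictScalars k

@[simp]
theorem orbitLinearMap_apply (v : V) (h : H) : orbitLinearMap k v h = h • v := rfl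

/-- A tensor in `H ⊗ H` killing `V ⊗ V` vanishes in the tensor square of `H` modulo the
annihilator of `V`. -/
theorem map_mkQ_annihilator_eq_zero [FiniteDimensional k H] {t : H ⊗[k] H}
    (ht : ∀ u v : V, TensorProduct.map (orbitLinearMap k u) (orbitLinearMap k v) t = 0) :
    TensorProduct.map ((Module.annihilator H V).restrictScalars k).mkQ
      ((Module.annihilator H V).restrictScalars k).mkQ t = 0 := by
  set I := (Module.annihilator H V).restrictScalars k with hI
  let S : Set (Module.Dual k H) :=
    {φ | ∃ (f : Module.Dual k V) (v : V), φ = f ∘ₗ orbitLinearMap k v}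
  -- The common zeros of the matrix coefficients in `S` form the annihilator.
  have hS {φ : Module.Dual k H} (hφ : ∀ x ∈ I, φ x = 0) : φ ∈ Submodule.span k S := by
    refine Module.Dual.mem_span_of_forall fun x hx => hφ x ?_
    rw [hI, Submodule.restrictScalars_mem, Module.mem_annihilator]
    intro v
    rw [← Module.forall_dual_apply_eq_zero_iff k]
    exact fun f => hx _ ⟨f, v, rfl⟩
  have hspan (a) (ha : a ∈ Submodule.span k S) (b) (hb : b ∈ Submodule.span k S) :
      TensorProduct.dualDistrib k H H (a ⊗ₜ b) t = 0 := by
    induction ha using Submodule.span_induction with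
    | zero => simp
    | add a a' _ _ ha ha' =>
      simp only [TensorProduct.add_tmul, map_add, LinearMap.add_apply, ha, ha', add_zero]
    | smul c a _ ha =>
      rw [← TensorProduct.smul_tmul', map_smul, LinearMap.smul_apply, ha, smul_zero]
    | mem a ha =>
      obtain ⟨f, u, rfl⟩ := ha
      induction hb using Submodule.span_induction with
      | zero => simp
      | add b b' _ _ hb hb' =>
        simp only [TensorProduct.tmul_add, map_add, LinearMap.add_apply, hb, hb', add_zero]
      | smul c b _ hb =>
        rw [TensorProduct.tmul_smul, map_smul, LinearMap.smul_apply, hb, smul_zero]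
      | mem b hb =>
        obtain ⟨g, v, rfl⟩ := hb
        rw [← TensorProduct.dualDistrib_map, ht, map_zero]
  have hq (χ : Module.Dual k (H ⧸ I)) : χ ∘ₗ I.mkQ ∈ Submodule.span k S :=
    hS fun x hx => by
      rw [LinearMap.comp_apply, Submodule.mkQ_apply, (Submodule.Quotient.mk_eq_zero I).2 hx,
        map_zero]
  refine TensorProduct.eq_zero_of_forall_dualDistrib fun φ ψ => ?_
  rw [TensorProduct.dualDistrib_map]
  exact hspan _ (hq φ) _ (hq ψ)

end Action

/-! ### Skew-symmetry and `π₂`-injectivity -/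

namespace VertexAlgebra

variable {V : Type*} [AddCommGroup V] [Module ℂ V] [VertexAlgebra V]

variable (V) in
/-- The `n`-th product `u ⊗ v ↦ u_n v` of a vertex algebra. -/
noncomputable def nthProduct (n : ℤ) : V →ₗ[ℂ] V →ₗ[ℂ] V :=
  (LinearMap.proj n ∘ₗ VertexOperator.ncoeff) ∘ₗ (Y : V →ₗ[ℂ] VertexOperator ℂ V)

theorem nthProduct_apply (n : ℤ) (u v : V) :
    nthProduct V n u v = VertexOperator.ncoeff (Y u) n v := rfl

theorem exists_forall_nthProduct_eq_zero (u v : V) :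
    ∃ K : ℤ, ∀ n : ℤ, K ≤ n → nthProduct V n u v = 0 := by
  refine ⟨- HahnSeries.order ((HahnModule.of ℂ).symm (Y u v)), fun n hn => ?_⟩
  exact VertexOperator.ncoeff_eq_zero_of_lt_order _ _ _ (by lia)

theorem finite_support_nthProduct_swap (u v : V) (r : ℤ) (c : ℕ → ℤ) :
    (Function.support fun i : ℕ => c i •
      nthProduct V (-1 - i) (nthProduct V (r + i) u v) vac).Finite := by
  obtain ⟨K, hK⟩ := exists_forall_nthProduct_eq_zero u v
  refine (Set.finite_lt_nat (K - r).toNat).subset fun i hi => ?_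
  by_contra hlt
  refine hi ?_
  simp only
  rw [hK _ (by simp at hlt; lia), map_zero, LinearMap.zero_apply, smul_zero]

/-- Skew-symmetry, with `w_{-1-i} 1` in place of `D ^ i w / i !`. -/
theorem nthProduct_swap (u v : V) (r : ℤ) :
    nthProduct V r v u = ∑ᶠ i : ℕ, (-(Int.negOnePow r : ℤ) * (-1 : ℤ) ^ i) •
      nthProduct V (-1 - i) (nthProduct V (r + i) u v) vac := by
  -- With `w = 1`, `p = -1`, `q = 0`, the first sum vanishes, only `i = 0` survives in the second,
  -- and the binomials on the right are all `1`.
  have h := jacobi u v vac (-1) 0 r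
  simp only [← nthProduct_apply] at h
  have hv (n : ℤ) (hn : 0 ≤ n) (w : V) : nthProduct V n w vac = 0 := ncoeff_vac_of_nonneg w n hn
  have h1 (i : ℕ) : nthProduct V (0 + i) v vac = 0 := hv _ (by lia) v
  simp only [h1, map_zero, smul_zero, finsum_zero, zero_sub] at h
  rw [finsum_eq_single _ 0] at h
  swap
  · intro i hi
    rw [hv _ (by lia), map_zero, smul_zero]
  have hu : nthProduct V (-1) u vac = u := ncoeff_neg_one_vac u
  have hc (i : ℕ) : Ring.choose ((i : ℤ) - (-1) - 1) i = 1 := by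
    rw [sub_neg_eq_add, add_sub_cancel_right, Ring.choose_natCast, Nat.choose_self, Nat.cast_one]
  simp only [hc, pow_zero, Ring.choose_zero_right, mul_one, Nat.cast_zero, add_zero, sub_zero,
    zero_add, hu] at h
  have hsq : -(Int.negOnePow r : ℤ) * -(Int.negOnePow r : ℤ) = 1 := by
    rw [neg_mul_neg, ← Units.val_mul, Int.units_mul_self, Units.val_one]
  simp only [mul_smul]
  rw [← smul_finsum' _ (finite_support_nthProduct_swap u v r _)]
  have h' := congrArg (fun x => -(Int.negOnePow r : ℤ) • x) h
  simp only [← neg_smul, smul_smul, hsq, one_smul] at h'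
  exact h'

theorem IsPiTwoInjective.eq_zero (hπ : IsPiTwoInjective V) {t : V ⊗[ℂ] V}
    (ht : ∀ n, TensorProduct.lift (nthProduct V n) t = 0) : t = 0 := by
  refine hπ ?_
  rw [map_zero]
  have key (n : ℤ) (t : V ⊗[ℂ] V) : ((HahnModule.of ℂ).symm (piTwo V t)).coeff n =
      TensorProduct.lift (nthProduct V (-n - 1)) t := by
    induction t using TensorProduct.induction_on with
    | zero => simp
    | tmul u v =>
      rw [TensorProduct.lift.tmul, nthProduct_apply, ← VertexOperator.coeff_eq_ncoeff]
      rfl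
    | add a b ha hb =>
      rw [map_add (TensorProduct.lift _), ← ha, ← hb, map_add (piTwo V)]
      rfl
  refine (HahnModule.of ℂ).symm.injective (HahnSeries.ext (funext fun n => ?_))
  rw [key, ht]
  rfl

end VertexAlgebra

/-! ### Hopf actions on vertex algebras -/

namespace IsHopfModuleVertexAlgebra

open VertexAlgebra

variable {H V : Type*} [Ring H] [HopfAlgebra ℂ H] [AddCommGroup V] [Module ℂ V]
  [VertexAlgebra V] [Module H V] [IsScalarTower ℂ H V]

theorem smul_nthProduct (hact : IsHopfModuleVertexAlgebra H V) (h : H) (u v : V) (n : ℤ) :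
    h • nthProduct V n u v = TensorProduct.lift (nthProduct V n)
      (TensorProduct.map (orbitLinearMap ℂ u) (orbitLinearMap ℂ v) (comul (R := ℂ) h)) := by
  rw [nthProduct_apply, hact.smul_ncoeff]
  conv_rhs => rw [← (ℛ ℂ h).eq]
  simp [nthProduct_apply]

/-- Replaces commutation of `h` with the translation operator in skew-symmetry. -/
theorem smul_nthProduct_vac (hact : IsHopfModuleVertexAlgebra H V) (h : H) (u : V) (n : ℤ) :
    h • nthProduct V n u vac = nthProduct V n (h • u) vac := by
  rw [hact.smul_nthProduct]
  have hvac : orbitLinearMap ℂ (vac : V) =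
      LinearMap.toSpanSingleton ℂ V vac ∘ₗ counit (R := ℂ) (A := H) :=
    LinearMap.ext hact.smul_vac
  have hu : orbitLinearMap ℂ u = orbitLinearMap ℂ u ∘ₗ (LinearMap.id (R := ℂ) (M := H)) := rfl
  rw [hvac, hu, TensorProduct.map_comp, LinearMap.comp_apply]
  change TensorProduct.lift _ (TensorProduct.map _ _ (counit.lTensor H (comul h))) = _
  rw [lTensor_counit_comul]
  simp

/-- Skew-symmetry makes the action on `n`-th products insensitive to swapping the legs of the
comultiplication. -/
theorem lift_nthProduct_map_comm (hact : IsHopfModuleVertexAlgebra H V) (h : H) (u v : V)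
    (r : ℤ) :
    TensorProduct.lift (nthProduct V r)
      (TensorProduct.map (orbitLinearMap ℂ v) (orbitLinearMap ℂ u)
        (TensorProduct.comm ℂ H H (comul (R := ℂ) h))) =
    TensorProduct.lift (nthProduct V r)
      (TensorProduct.map (orbitLinearMap ℂ v) (orbitLinearMap ℂ u) (comul (R := ℂ) h)) := by
  rw [← hact.smul_nthProduct, nthProduct_swap u v r,
    smul_finsum' h (finite_support_nthProduct_swap u v r _)]
  have hterm (i : ℕ) : h • ((-(Int.negOnePow r : ℤ) * (-1 : ℤ) ^ i) •
        nthProduct V (-1 - i) (nthProduct V (r + i) u v) vac) =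
      ∑ j ∈ (ℛ ℂ h).index, (-(Int.negOnePow r : ℤ) * (-1 : ℤ) ^ i) • nthProduct V (-1 - i)
        (nthProduct V (r + i) ((ℛ ℂ h).left j • u) ((ℛ ℂ h).right j • v)) vac := by
    rw [smul_comm h, hact.smul_nthProduct_vac,
      nthProduct_apply (r + i), hact.smul_ncoeff, map_sum, LinearMap.sum_apply, Finset.smul_sum]
    rfl
  simp only [hterm]
  -- After exchanging the sums, skew-symmetry is undone for each summand of `Δ(h)`, which leaves the
  -- legs swapped.
  rw [finsum_sum_comm _ (fun (i : ℕ) j => (-(Int.negOnePow r : ℤ) * (-1 : ℤ) ^ i) •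
    nthProduct V (-1 - i) (nthProduct V (r + i) ((ℛ ℂ h).left j • u) ((ℛ ℂ h).right j • v)) vac)
    fun j _ => finite_support_nthProduct_swap _ _ r _]
  simp only [← nthProduct_swap]
  conv_lhs => rw [← (ℛ ℂ h).eq]
  simp

theorem map_orbitLinearMap_comm (hact : IsHopfModuleVertexAlgebra H V)
    (hπ : IsPiTwoInjective V) (h : H) (u v : V) :
    TensorProduct.map (orbitLinearMap ℂ u) (orbitLinearMap ℂ v)
      (TensorProduct.comm ℂ H H (comul (R := ℂ) h) - comul (R := ℂ) h) = 0 := by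
  refine hπ.eq_zero fun n => ?_
  rw [map_sub, map_sub, sub_eq_zero, hact.lift_nthProduct_map_comm]

theorem map_orbitLinearMap_comul_eq_zero (hact : IsHopfModuleVertexAlgebra H V)
    (hπ : IsPiTwoInjective V) {h : H} (hh : h ∈ Module.annihilator H V) (u v : V) :
    TensorProduct.map (orbitLinearMap ℂ u) (orbitLinearMap ℂ v) (comul (R := ℂ) h) = 0 := by
  refine hπ.eq_zero fun n => ?_
  rw [← hact.smul_nthProduct]
  exact Module.mem_annihilator.1 hh _

/-- If the vacuum vanishes, so does the vertex algebra. -/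
theorem _root_.VertexAlgebra.subsingleton_of_vac_eq_zero (h : (vac : V) = 0) :
    Subsingleton V :=
  subsingleton_of_forall_eq 0 fun u => by rw [← ncoeff_neg_one_vac u, h, map_zero]

/-- The annihilator of a nonzero `π₂`-injective module vertex algebra is a coideal. -/
theorem isCoideal_annihilator [FiniteDimensional ℂ H] [Nontrivial V]
    (hact : IsHopfModuleVertexAlgebra H V) (hπ : IsPiTwoInjective V) :
    ((Module.annihilator H V).restrictScalars ℂ).IsCoideal where
  counit_eq_zero x hx := by
    have h1 : x • (vac : V) = 0 := Module.mem_annihilator.1 hx vac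
    rw [hact.smul_vac] at h1
    exact (smul_eq_zero.1 h1).resolve_right fun h =>
      not_subsingleton V (subsingleton_of_vac_eq_zero h)
  map_mkQ_comul_eq_zero x hx :=
    map_mkQ_annihilator_eq_zero ℂ (hact.map_orbitLinearMap_comul_eq_zero hπ hx)

theorem isCocomm [FiniteDimensional ℂ H] (hact : IsHopfModuleVertexAlgebra H V)
    (hπ : IsPiTwoInjective V) (hinner : IsInnerFaithful H V) : IsCocomm ℂ H := by
  rcases subsingleton_or_nontrivial V with hV | hV
  -- For `V = 0` every Hopf ideal kills `V`, so the augmentation ideal is zero.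
  · refine HopfAlgebra.isCocomm_of_ker_counitAlgHom_eq_bot ?_
    by_contra hne
    obtain ⟨a, -, m, ham⟩ := hinner _ inferInstance
      (HopfAlgebra.isHopfIdeal_ker_counitAlgHom ℂ H) hne
    exact ham (Subsingleton.elim _ _)
  · have hbot : Module.annihilator H V = ⊥ := by
      by_contra hne
      obtain ⟨a, ha, m, ham⟩ := hinner _ inferInstance
        (Ideal.isHopfIdeal_of_isCoideal _ (hact.isCoideal_annihilator hπ)) hne
      exact ham (Module.mem_annihilator.1 ha m)
    refine ⟨LinearMap.ext fun h => sub_eq_zero.1 ?_⟩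
    have h0 := map_mkQ_annihilator_eq_zero ℂ (hact.map_orbitLinearMap_comm hπ h)
    have hinj : Function.Injective ((Module.annihilator H V).restrictScalars ℂ).mkQ := by
      rw [← LinearMap.ker_eq_bot, Submodule.ker_mkQ, hbot]
      rfl
    exact TensorProduct.map_injective_of_flat_flat _ _ hinj hinj (h0.trans (map_zero _).symm)

end IsHopfModuleVertexAlgebra

theorem theorem5p4 (H : Type u) [Ring H] [HopfAlgebra ℂ H] [FiniteDimensional ℂ H]
    (V : Type v) [AddCommGroup V] [Module ℂ V] [VertexAlgebra V]
    (hπ : VertexAlgebra.IsPiTwoInjective V)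
    [Module H V] [IsScalarTower ℂ H V]
    (hact : IsHopfModuleVertexAlgebra H V) (hinner : IsInnerFaithful H V) :
    Coalgebra.IsCocomm ℂ H ∧ IsGroupAlgebra H :=
  have : IsCocomm ℂ H := hact.isCocomm hπ hinner
  ⟨this, isGroupAlgebra_of_isCocomm H⟩
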